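/- Let $p\in(1,\infty)$. A norm $N$ on a complex vector space $X$ is called a $p$-norm if for every $n\in\mathbb N$ and every matrix $M\in M_n(\mathbb C)$ satisfying $\sum_{i}|\sum_j M_{ij}s_j|^p\le\sum_k|s_k|^p$ for all $s\in\mathbb C^n$ one has $\sum_i N(\sum_j M_{ij}x_j)^p\le\sum_k N(x_k)^p$ for all $x_1,\dots,x_n\in X$. A $p$-space is a complex Banach space whose norm is a $p$-norm (equivalently, by Kwapień, a space isometrically isomorphic to a quotient of a closed subspace of an $L^p$-space). Let $\Gamma$ be a discrete group. A representation $\pi\colon\Gamma\to\mathrm{GL}(X)$ by bounded invertible operators is uniformly bounded if $\sup_{g\in\Gamma}\|\pi(g)\|<\infty$, and it is $q$-isometrisable if there is a $q$-norm on $X$, equivalent to the given norm, for which every $\pi(g)$ is isometric. The group $\Gamma$ is $(p,q)$-isometrisable if every uniformly bounded representation of $\Gamma$ on any $p$-space is $q$-isometrisable, and $p$-isometrisable if it is $(p,p)$-isometrisable. Theorem. Let $p\in(1,\infty)$. (1) For every integer $r\ge 2$ the free group $\mathbb F_r$ on $r$ generators is not $(2,p)$-isometrisable. More explicitly, there are a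 complex Hilbert space $H$, which is also a $p$-space, and a uniformly bounded representation of $\mathbb F_r$ on $H$ that is not $p$-isometrisable. In particular, $\mathbb F_r$ is not $p$-isometrisable. (2) No group containing a non-abelian free subgroup is $p$-isometrisable. -/

import Mathlib

universe u v

/-- `N` is a `p`-norm on the complex vector space `X`: every complex `n × n` matrix which is a
contraction of the `n`-dimensional space `ℓ^p` also acts as a contraction on the `ℓ^p`-sum of `n`
copies of `(X, N)`.  (That `N` is definite is not part of this property.) -/
def IsPNorm (p : ℝ) {X : Type v} [AddCommGroup X] [Module ℂ X] (N : Seminorm ℂ X) : Prop :=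
  ∀ (n : ℕ) (M : Matrix (Fin n) (Fin n) ℂ),
    (∀ s : Fin n → ℂ, ∑ i, ‖∑ j, M i j * s j‖ ^ p ≤ ∑ k, ‖s k‖ ^ p) →
      ∀ x : Fin n → X, ∑ i, N (∑ j, M i j • x j) ^ p ≤ ∑ k, N (x k) ^ p

/-- `X` is a `p`-space: a complex Banach space whose norm is a `p`-norm. -/
def IsPSpace (p : ℝ) (X : Type v) [NormedAddCommGroup X] [NormedSpace ℂ X] : Prop :=
  CompleteSpace X ∧ IsPNorm p (normSeminorm ℂ X)

/-- The representation `π : Γ → GL(X)` is uniformly bounded: `sup_g ‖π(g)‖ < ∞`. -/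
def IsUniformlyBounded {Γ : Type u} [Group Γ] {X : Type v} [NormedAddCommGroup X]
    [NormedSpace ℂ X] (π : Γ →* (X →L[ℂ] X)ˣ) : Prop :=
  ∃ C : ℝ, ∀ g : Γ, ‖(π g : X →L[ℂ] X)‖ ≤ C

/-- `N` is a norm on `X` equivalent to the given one. -/
def IsEquivalentNorm {X : Type v} [NormedAddCommGroup X] [NormedSpace ℂ X]
    (N : Seminorm ℂ X) : Prop :=
  ∃ c C : ℝ, 0 < c ∧ ∀ x : X, c * ‖x‖ ≤ N x ∧ N x ≤ C * ‖x‖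

/-- The representation `π` is `q`-isometrisable: there is an equivalent `q`-norm on `X` for which
every `π(g)` is isometric. -/
def IsIsometrisableRep (q : ℝ) {Γ : Type u} [Group Γ] {X : Type v} [NormedAddCommGroup X]
    [NormedSpace ℂ X] (π : Γ →* (X →L[ℂ] X)ˣ) : Prop :=
  ∃ N : Seminorm ℂ X, IsEquivalentNorm N ∧ IsPNorm q N ∧
    ∀ (g : Γ) (x : X), N ((π g : X →L[ℂ] X) x) = N x

/-- The discrete group `Γ` is `(p,q)`-isometrisable: every uniformly bounded representation of `Γ`
on a `p`-space is `q`-isometrisable.  The space ranges over the universe of `Γ`. -/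
def IsPQIsometrisable (p q : ℝ) (Γ : Type u) [Group Γ] : Prop :=
  ∀ (X : Type u) [NormedAddCommGroup X] [NormedSpace ℂ X], IsPSpace p X →
    ∀ π : Γ →* (X →L[ℂ] X)ˣ, IsUniformlyBounded π → IsIsometrisableRep q π

/-- The group `Γ` is `p`-isometrisable if it is `(p,p)`-isometrisable. -/
def IsPIsometrisable (p : ℝ) (Γ : Type u) [Group Γ] : Prop :=
  IsPQIsometrisable p p Γ

/-- `Γ` contains a non-abelian free subgroup. -/
def ContainsNonabelianFree (Γ : Type u) [Group Γ] : Prop :=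
  ∃ H : Subgroup Γ, IsFreeGroup H ∧ ∃ a ∈ H, ∃ b ∈ H, a * b ≠ b * a

/-! The core is one uniformly bounded Hilbert space representation of the free group on infinitely
many generators. View the group as a rooted tree, the parent of a word being obtained by deleting
its first letter, and conjugate right translation by `D u = u - z (u ∘ parent)`, with `|z| < 1`.
Right multiplication by `g` respects parents except on the geodesic from `1` to `g⁻¹`. Off that path
the conjugated operator is plain translation; on it `D` is `1 - zS` with `S` a truncated shift, so
its norm is at most `2` and that of its inverse at most `1 / (1 - |z|)`. This gives a uniform bound
on `ℓ²`.

Since `D` maps `x ↦ z ^ |x|` to `e = δ₁`, the coefficient of `π(g)e` at `1` is `z ^ |g|`. For `g =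
a⁻¹ b` with distinct generators `a`, `b` it is `z²`, which is negative for imaginary `z`, and the
other two terms of `π(g)e` tend weakly to `0` as the generators go to infinity
(`deformedTranslation_single_one`, `tendsto_apply_single`).

Suppose `N` is an equivalent invariant `p`-norm, and let `φ` be a supporting functional of `N` at
`e`. The projection `A` of `ℂ³` onto mean-zero vectors has norm at most some `K < 4/3` on `ℓ^p`
(`exists_sum_centering_le`), because `1 < p < ∞`. Hence `|∑ A i j φ(π(gᵢ⁻¹ gⱼ)e)| ≤ 3 K N(e)`
(`IsPNorm.sum_centering_le`), whereas for generators going to infinity the sum tends to `(2 - 2z²)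
N(e)`. With `|z|` close to `1` this approaches `4 N(e)`, a contradiction.

Two transfers finish the proof. Hilbert spaces are `p`-spaces, since `‖x‖ ^ p` is proportional to an
integral of `|⟨v, x⟩| ^ p` over a unitarily invariant measure. Non-isometrisability passes to
overgroups by unitary-style induction (`exists_inducedRep`), and every non-abelian free group
contains a free group of infinite rank. -/

namespace FreeGroup

/-! ### The rooted tree of reduced words and its geodesics to the root -/

section Suffix
variable {X : Type*} [DecidableEq X]

/-- The neighbour of a reduced word obtained by deleting its first letter. -/
def parent (x : FreeGroup X) : FreeGroup X := mk x.toWord.tail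

theorem toWord_mk_of_isReduced {l : List (X × Bool)} (h : IsReduced l) : (mk l).toWord = l := by
  rw [toWord_mk, h.reduce_eq]

theorem isReduced_of_suffix {l : List (X × Bool)} {g : FreeGroup X} (h : l <:+ g.toWord) :
    IsReduced l := isReduced_toWord.infix h.isInfix

theorem toWord_parent (x : FreeGroup X) : (parent x).toWord = x.toWord.tail :=
  toWord_mk_of_isReduced (isReduced_of_suffix (List.tail_suffix _))

theorem parent_mk_cons {a : X × Bool} {l : List (X × Bool)} (h : IsReduced (a :: l)) :
    parent (mk (a :: l)) = mk l := by
  rw [parent, toWord_mk_of_isReduced h, List.tail_cons]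

/-- The elements of the free group whose reduced word is a suffix of that of `g`. -/
def suffixes (g : FreeGroup X) : Finset (FreeGroup X) := (g.toWord.tails.map mk).toFinset

theorem mem_suffixes {x g : FreeGroup X} : x ∈ suffixes g ↔ x.toWord <:+ g.toWord := by
  simp only [suffixes, List.mem_toFinset, List.mem_map, List.mem_tails]
  constructor
  · rintro ⟨l, hl, rfl⟩
    rwa [toWord_mk_of_isReduced (isReduced_of_suffix hl)]
  · exact fun h => ⟨_, h, mk_toWord⟩

theorem parent_mem_suffixes {x g : FreeGroup X} (h : x ∈ suffixes g) : parent x ∈ suffixes g := by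
  rw [mem_suffixes] at h ⊢
  rw [toWord_parent]
  exact (List.tail_suffix _).trans h

theorem parent_injOn_suffixes {x y g : FreeGroup X} (hx : x ∈ suffixes g) (hy : y ∈ suffixes g)
    (hx1 : x ≠ 1) (hy1 : y ≠ 1) (h : parent x = parent y) : x = y := by
  rw [mem_suffixes] at hx hy
  have hl : x.toWord.length = y.toWord.length := by
    have := congrArg (fun w => w.toWord.length) h
    simp only [toWord_parent, List.length_tail] at this
    have h1 : x.toWord.length ≠ 0 := by simpa using hx1
    have h2 : y.toWord.length ≠ 0 := by simpa using hy1
    omega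
  apply toWord_injective
  exact (List.suffix_of_suffix_length_le hx hy hl.le).eq_of_length hl

theorem toWord_mul_of_mem_suffixes {x g : FreeGroup X} {l : List (X × Bool)}
    (h : g⁻¹.toWord = l ++ x.toWord) : (x * g).toWord = invRev l := by
  have hg : g = (mk l * x)⁻¹ := by
    rw [← inv_inv g, ← mk_toWord (x := g⁻¹), h, ← mul_mk, mk_toWord]
  have : x * g = (mk l)⁻¹ := by rw [hg]; group
  rw [this, toWord_inv, toWord_mk_of_isReduced]
  exact (isReduced_toWord (x := g⁻¹)).infix ⟨[], x.toWord, by simp [h]⟩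

theorem mul_mem_suffixes {x g : FreeGroup X} (h : x ∈ suffixes g⁻¹) : x * g ∈ suffixes g := by
  rw [mem_suffixes] at h ⊢
  obtain ⟨l, hl⟩ := h
  rw [toWord_mul_of_mem_suffixes hl.symm]
  have h2 : g.toWord = invRev (g⁻¹).toWord := by rw [toWord_inv, invRev_invRev]
  rw [h2, ← hl]
  exact ⟨invRev x.toWord, by rw [invRev_append]⟩

theorem one_mem_suffixes (g : FreeGroup X) : 1 ∈ suffixes g := by simp [mem_suffixes]

theorem self_mem_suffixes (g : FreeGroup X) : g ∈ suffixes g := by simp [mem_suffixes]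

/-- A letter of a reduced word can cancel against `g` only after all letters to its right have
cancelled, and then the word is a terminal segment of that of `g⁻¹`. -/
theorem mem_suffixes_or_toWord_mul (g : FreeGroup X) (l : List (X × Bool)) (a : X × Bool)
    (h : IsReduced (a :: l)) : mk (a :: l) ∈ suffixes g⁻¹ ∨
      (mk (a :: l) * g).toWord = a :: (mk l * g).toWord := by
  by_cases hc : (mk (a :: l) * g).toWord = a :: (mk l * g).toWord
  · exact Or.inr hc
  refine Or.inl ?_
  obtain ⟨t, ht⟩ : ∃ t, (mk l * g).toWord = (a.1, !a.2) :: t := by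
    have e : (mk (a :: l) * g).toWord = reduce (a :: (mk l * g).toWord) := by
      rw [← toWord_mk, show a :: (mk l * g).toWord = [a] ++ (mk l * g).toWord from rfl,
        ← mul_mk, mk_toWord, ← mul_assoc, mul_mk]; rfl
    rw [e, reduce.cons, reduce_toWord] at hc
    cases hw : (mk l * g).toWord with
    | nil => simp [hw] at hc
    | cons b t =>
      rw [hw] at hc
      simp only [] at hc
      split_ifs at hc with hab
      · obtain ⟨h1, h2⟩ := hab
        refine ⟨t, ?_⟩
        congr 1
        ext
        · exact h1.symm
        · simp [h2]
      · exact absurd rfl hc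
  have hl : IsReduced l := h.infix (List.suffix_cons a l).isInfix
  -- Otherwise the first letter `b` of `l` survives in `mk l * g`; being cancelled by `a`, it is the
  -- inverse of `a`, against reducedness of `a :: l`.
  have key : mk l ∈ suffixes g⁻¹ := by
    cases l with
    | nil => exact one_mem_suffixes _
    | cons b l =>
      rcases mem_suffixes_or_toWord_mul g l b hl with h' | h'
      · exact h'
      · rw [h'] at ht
        have hb : b = (a.1, !a.2) := (List.cons.inj ht).1
        have := (isReduced_cons_cons.1 h).1
        simp [hb] at this
  rw [mem_suffixes, toWord_mk_of_isReduced hl] at key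
  obtain ⟨q, hq⟩ := key
  have h3 := toWord_mul_of_mem_suffixes (x := mk l) (g := g) (l := q)
    (by rw [toWord_mk_of_isReduced hl, hq])
  rw [ht] at h3
  rw [mem_suffixes, toWord_mk_of_isReduced h, ← hq]
  have h4 : q = invRev ((a.1, !a.2) :: t) := by rw [h3, invRev_invRev]
  rw [h4]
  exact ⟨invRev t, by simp [invRev]⟩
termination_by l.length

theorem parent_mul_of_notMem_suffixes {x g : FreeGroup X} (h : x ∉ suffixes g⁻¹) :
    parent (x * g) = parent x * g := by
  have hx : IsReduced x.toWord := isReduced_toWord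
  have e : mk x.toWord = x := mk_toWord
  cases hw : x.toWord with
  | nil =>
    rw [toWord_eq_nil_iff] at hw
    exact absurd (hw ▸ one_mem_suffixes _) h
  | cons a l =>
    rw [hw] at hx e
    have := (mem_suffixes_or_toWord_mul g l a hx).resolve_left (by rwa [e])
    rw [e] at this
    rw [parent, this, List.tail_cons, mk_toWord, parent, hw, List.tail_cons]

theorem mul_ne_one_of_notMem_suffixes {x g : FreeGroup X} (h : x ∉ suffixes g⁻¹) : x * g ≠ 1 := by
  intro hxg
  rw [eq_inv_of_mul_eq_one_left hxg] at h
  exact h (self_mem_suffixes _)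

end Suffix

end FreeGroup

namespace FreeGroup

/-! ### Uniformly bounded deformation of the right regular representation -/

section RootedDifference
variable {X : Type*}

/-- The right regular representation on the space of all functions. -/
def translation : FreeGroup X →* Module.End ℂ (FreeGroup X → ℂ) where
  toFun g := LinearMap.funLeft ℂ ℂ (· * g)
  map_one' := by ext; simp [LinearMap.funLeft]
  map_mul' g h := by
    ext u x
    simp [LinearMap.funLeft, mul_assoc]

theorem translation_apply (g : FreeGroup X) (u : FreeGroup X → ℂ) (x : FreeGroup X) :
    translation g u x = u (x * g) := rfl

variable [DecidableEq X]

/-- The operator `u ↦ u - z • (u ∘ parent)` on functions on the free group, where the second term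
is absent at the root. -/
def rootedDiff (z : ℂ) : (FreeGroup X → ℂ) →ₗ[ℂ] (FreeGroup X → ℂ) where
  toFun u x := u x - if x = 1 then 0 else z * u (parent x)
  map_add' u v := by
    funext x
    simp only [Pi.add_apply]
    split_ifs <;> ring
  map_smul' c u := by
    funext x
    simp only [Pi.smul_apply, smul_eq_mul, RingHom.id_apply]
    split_ifs <;> ring

theorem rootedDiff_apply (z : ℂ) (u : FreeGroup X → ℂ) (x : FreeGroup X) :
    rootedDiff z u x = u x - if x = 1 then 0 else z * u (parent x) := rfl

/-- The solution of `rootedDiff z u = h`, computed along a word. -/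
def rootedSum (z : ℂ) (h : FreeGroup X → ℂ) : List (X × Bool) → ℂ
  | [] => h 1
  | a :: l => h (mk (a :: l)) + z * rootedSum z h l

theorem rootedSum_rootedDiff (z : ℂ) (u : FreeGroup X → ℂ) :
    ∀ l : List (X × Bool), IsReduced l → rootedSum z (rootedDiff z u) l = u (mk l)
  | [], _ => by simp [rootedSum, rootedDiff_apply, one_eq_mk]
  | a :: l, h => by
    have h1 : (mk (a :: l) : FreeGroup X) ≠ 1 := by
      rw [Ne, ← toWord_eq_nil_iff, toWord_mk_of_isReduced h]
      simp
    rw [rootedSum, rootedSum_rootedDiff z u l (h.infix (List.suffix_cons a l).isInfix),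
      rootedDiff_apply, if_neg h1, parent_mk_cons h]
    ring

theorem rootedDiff_rootedSum (z : ℂ) (h : FreeGroup X → ℂ) :
    rootedDiff z (fun x => rootedSum z h x.toWord) = h := by
  funext x
  rw [rootedDiff_apply]
  have e : mk x.toWord = x := mk_toWord
  rw [toWord_parent]
  cases hw : x.toWord with
  | nil =>
    rw [toWord_eq_nil_iff] at hw
    simp [hw, rootedSum]
  | cons a l =>
    have h1 : x ≠ 1 := by
      rw [Ne, ← toWord_eq_nil_iff, hw]
      simp
    rw [if_neg h1, List.tail_cons, rootedSum, ← hw, e]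
    ring

/-- `rootedDiff z` as a linear automorphism of the space of all functions. -/
def rootedDiffEquiv (z : ℂ) : (FreeGroup X → ℂ) ≃ₗ[ℂ] (FreeGroup X → ℂ) :=
  { rootedDiff z with
    invFun := fun h x => rootedSum z h x.toWord
    left_inv := fun u => by
      funext x
      have := rootedSum_rootedDiff z u x.toWord isReduced_toWord
      rwa [mk_toWord] at this
    right_inv := fun h => rootedDiff_rootedSum z h }

theorem rootedDiffEquiv_apply (z : ℂ) (u : FreeGroup X → ℂ) :
    rootedDiffEquiv z u = rootedDiff z u := rfl

/-- The right regular representation conjugated by `rootedDiff z`. -/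
def deformedTranslation (z : ℂ) : FreeGroup X →* Module.End ℂ (FreeGroup X → ℂ) :=
  (rootedDiffEquiv z).conjRingEquiv.toMonoidHom.comp translation

theorem deformedTranslation_rootedDiff (z : ℂ) (g : FreeGroup X) (u : FreeGroup X → ℂ) :
    deformedTranslation z g (rootedDiff z u) = rootedDiff z (translation g u) := by
  rw [← rootedDiffEquiv_apply, ← rootedDiffEquiv_apply]
  simp [deformedTranslation]

theorem rootedDiff_translation (z : ℂ) {x g : FreeGroup X} (u : FreeGroup X → ℂ)
    (h : x ∉ suffixes g⁻¹) : rootedDiff z (translation g u) x = rootedDiff z u (x * g) := by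
  have h1 : x ≠ 1 := fun h1 => h (h1 ▸ one_mem_suffixes _)
  rw [rootedDiff_apply, rootedDiff_apply, if_neg h1, if_neg (mul_ne_one_of_notMem_suffixes h),
    translation_apply, translation_apply, parent_mul_of_notMem_suffixes h]

/-- On a geodesic `parent` is injective, so `u ↦ u ∘ parent` is a truncated shift there. On the
whole tree it is unbounded in `ℓ²` when there are infinitely many generators; this is why the
conjugation takes place on all functions. -/
theorem sum_parent_le (g : FreeGroup X) (w : FreeGroup X → ℝ) (hw : ∀ x, 0 ≤ w x) :
    ∑ x ∈ suffixes g, (if x = 1 then 0 else w (parent x)) ≤ ∑ x ∈ suffixes g, w x := by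
  simp_rw [← ite_not (_ = (1 : FreeGroup X))]
  rw [← Finset.sum_filter, ← Finset.sum_image (f := w) (g := parent)]
  · apply Finset.sum_le_sum_of_subset_of_nonneg
    · intro y hy
      obtain ⟨x, hx, rfl⟩ := Finset.mem_image.1 hy
      exact parent_mem_suffixes (Finset.mem_filter.1 hx).1
    · exact fun _ _ _ => hw _
  · intro x hx y hy hxy
    simp only [Finset.coe_filter, Set.mem_ofPred_eq] at hx hy
    exact parent_injOn_suffixes hx.1 hy.1 hx.2 hy.2 hxy

theorem sum_rootedDiff_le {z : ℂ} (hz : ‖z‖ < 1) (g : FreeGroup X) (u : FreeGroup X → ℂ) :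
    ∑ x ∈ suffixes g, ‖rootedDiff z u x‖ ^ 2 ≤ 4 * ∑ x ∈ suffixes g, ‖u x‖ ^ 2 := by
  have h1 := sum_parent_le g (fun x => ‖u x‖ ^ 2) (fun _ => by positivity)
  have h2 : ∀ x ∈ suffixes g, ‖rootedDiff z u x‖ ^ 2 ≤
      2 * ‖u x‖ ^ 2 + 2 * (if x = 1 then 0 else ‖u (parent x)‖ ^ 2) := by
    intro x _
    rw [rootedDiff_apply]
    split_ifs
    · simp only [sub_zero]
      nlinarith [sq_nonneg ‖u x‖]
    · have h3 : ‖u x - z * u (parent x)‖ ≤ ‖u x‖ + ‖u (parent x)‖ := by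
        refine (norm_sub_le _ _).trans ?_
        rw [norm_mul]
        gcongr
        exact mul_le_of_le_one_left (norm_nonneg _) hz.le
      have h4 := pow_le_pow_left₀ (norm_nonneg _) h3 2
      nlinarith [sq_nonneg (‖u x‖ - ‖u (parent x)‖)]
  have h5 := Finset.sum_le_sum h2
  rw [Finset.sum_add_distrib, ← Finset.mul_sum, ← Finset.mul_sum] at h5
  linarith

theorem le_sum_rootedDiff {z : ℂ} (hz : ‖z‖ < 1) (g : FreeGroup X) (u : FreeGroup X → ℂ) :
    (1 - ‖z‖) ^ 2 * ∑ x ∈ suffixes g, ‖u x‖ ^ 2 ≤ ∑ x ∈ suffixes g, ‖rootedDiff z u x‖ ^ 2 := by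
  have h1 := sum_parent_le g (fun x => ‖u x‖ ^ 2) (fun _ => by positivity)
  set r := ‖z‖
  have hr : 0 ≤ r := norm_nonneg z
  have h2 : ∀ x ∈ suffixes g, (1 - r) * ‖u x‖ ^ 2 ≤
      ‖rootedDiff z u x‖ ^ 2 + r * (1 - r) * (if x = 1 then 0 else ‖u (parent x)‖ ^ 2) := by
    intro x _
    rw [rootedDiff_apply]
    split_ifs
    · simp only [sub_zero]
      nlinarith [sq_nonneg ‖u x‖]
    · have h3 : ‖u x‖ ≤ ‖u x - z * u (parent x)‖ + r * ‖u (parent x)‖ := by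
        have := norm_add_le (u x - z * u (parent x)) (z * u (parent x))
        rwa [sub_add_cancel, norm_mul] at this
      have h4 := pow_le_pow_left₀ (norm_nonneg _) h3 2
      set a := ‖u x - z * u (parent x)‖
      set b := ‖u (parent x)‖
      -- Convexity of the square, applied to `a + r b = (1 - r) (a / (1 - r)) + r b`.
      have h5 : (1 - r) * (a + r * b) ^ 2 ≤ a ^ 2 + r * (1 - r) * b ^ 2 := by
        have : a ^ 2 + r * (1 - r) * b ^ 2 - (1 - r) * (a + r * b) ^ 2 =
          r * (a - (1 - r) * b) ^ 2 := by ring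
        nlinarith [mul_nonneg hr (sq_nonneg (a - (1 - r) * b))]
      nlinarith [mul_le_mul_of_nonneg_left h4 (sub_nonneg.2 hz.le)]
  have h5 := Finset.sum_le_sum h2
  rw [Finset.sum_add_distrib, ← Finset.mul_sum, ← Finset.mul_sum] at h5
  have h6 := mul_le_mul_of_nonneg_left h1 (mul_nonneg hr (sub_nonneg.2 hz.le))
  nlinarith

theorem sum_translation_suffixes (g : FreeGroup X) (w : FreeGroup X → ℝ) :
    ∑ x ∈ suffixes g⁻¹, w (x * g) = ∑ x ∈ suffixes g, w x := by
  refine Finset.sum_bij' (fun x _ => x * g) (fun x _ => x * g⁻¹) (fun x hx => mul_mem_suffixes hx)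
    (fun x hx => mul_mem_suffixes (by rwa [inv_inv])) ?_ ?_ ?_ <;> simp

theorem sum_deformedTranslation_suffixes_le {z : ℂ} (hz : ‖z‖ < 1) (g : FreeGroup X)
    (f : FreeGroup X → ℂ) : ∑ x ∈ suffixes g⁻¹, ‖deformedTranslation z g f x‖ ^ 2 ≤
      (2 / (1 - ‖z‖)) ^ 2 * ∑ x ∈ suffixes g, ‖f x‖ ^ 2 := by
  obtain ⟨u, rfl⟩ := (rootedDiffEquiv z).surjective f
  rw [rootedDiffEquiv_apply, deformedTranslation_rootedDiff]
  have h0 : 0 < 1 - ‖z‖ := sub_pos.2 hz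
  have h1 := sum_rootedDiff_le hz g⁻¹ (translation g u)
  have h2 := sum_translation_suffixes g (fun x => ‖u x‖ ^ 2)
  simp only [translation_apply] at h1
  rw [h2] at h1
  have h3 := le_sum_rootedDiff hz g u
  rw [div_pow, div_mul_eq_mul_div, le_div_iff₀ (by positivity)]
  nlinarith [sq_nonneg (1 - ‖z‖)]

/-- The `ℓ²` bound is phrased with finite sums so that it makes sense for arbitrary functions. The
geodesic contributes the constant; elsewhere the operator is translation by `g`, and the two images
are disjoint. -/
theorem exists_sum_deformedTranslation_le {z : ℂ} (hz : ‖z‖ < 1) (g : FreeGroup X)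
    (f : FreeGroup X → ℂ) (s : Finset (FreeGroup X)) : ∃ t : Finset (FreeGroup X),
      ∑ x ∈ s, ‖deformedTranslation z g f x‖ ^ 2 ≤
        (2 / (1 - ‖z‖)) ^ 2 * ∑ x ∈ t, ‖f x‖ ^ 2 := by
  have h0 : 0 < 1 - ‖z‖ := sub_pos.2 hz
  have hK : 1 ≤ (2 / (1 - ‖z‖)) ^ 2 := by
    apply one_le_pow₀
    rw [le_div_iff₀ h0]
    linarith [norm_nonneg z]
  refine ⟨suffixes g ∪ (s \ suffixes g⁻¹).image (· * g), ?_⟩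
  rw [Finset.sum_union, mul_add]
  · have h1 : ∑ x ∈ s, ‖deformedTranslation z g f x‖ ^ 2 ≤
        ∑ x ∈ suffixes g⁻¹ ∪ (s \ suffixes g⁻¹), ‖deformedTranslation z g f x‖ ^ 2 := by
      apply Finset.sum_le_sum_of_subset_of_nonneg
      · simp
      · intros; positivity
    rw [Finset.sum_union Finset.disjoint_sdiff] at h1
    refine h1.trans (add_le_add (sum_deformedTranslation_suffixes_le hz g f) ?_)
    rw [Finset.sum_image (fun _ _ _ _ h => mul_right_cancel h)]
    refine le_trans (le_of_eq ?_) (le_mul_of_one_le_left (by positivity) hK)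
    refine Finset.sum_congr rfl fun x hx => ?_
    obtain ⟨u, rfl⟩ := (rootedDiffEquiv z).surjective f
    rw [rootedDiffEquiv_apply, deformedTranslation_rootedDiff,
      rootedDiff_translation z u (Finset.mem_sdiff.1 hx).2]
  · rw [Finset.disjoint_left]
    intro y hy hy'
    obtain ⟨x, hx, rfl⟩ := Finset.mem_image.1 hy'
    have := mul_mem_suffixes (x := x * g) (g := g⁻¹) (by rwa [inv_inv])
    rw [mul_inv_cancel_right] at this
    exact (Finset.mem_sdiff.1 hx).2 this

theorem rootedDiff_pow_norm (z : ℂ) :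
    rootedDiff z (fun x : FreeGroup X => z ^ x.norm) = Pi.single 1 1 := by
  funext x
  rw [rootedDiff_apply]
  by_cases h : x = 1
  · simp [h]
  · have h1 : x.norm = (parent x).norm + 1 := by
      have : x.toWord.length ≠ 0 := by simpa using h
      rw [norm, norm, toWord_parent, List.length_tail]
      omega
    rw [if_neg h, h1, pow_succ, Pi.single_eq_of_ne h]
    ring

/-- The image of `δ₁` is supported on the geodesic from `1` to `g⁻¹`, here the three points `1`, `of
i` and `(of j)⁻¹ * of i`, where `|x g|` equals `2`, `1` and `0`. -/
theorem deformedTranslation_single_one (z : ℂ) {i j : X} (hij : i ≠ j) :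
    deformedTranslation z ((of i)⁻¹ * of j) (Pi.single 1 1) =
      (Pi.single 1 (z ^ 2 : ℂ) + Pi.single (of i) (z - z ^ 3 : ℂ) +
        Pi.single ((of j)⁻¹ * of i) (1 - z ^ 2 : ℂ) : FreeGroup X → ℂ) := by
  have hred : IsReduced [(j, false), (i, true)] := by
    rw [isReduced_cons_cons]
    exact ⟨fun h => absurd h.symm hij, IsReduced.singleton⟩
  have hred' : IsReduced [(i, false), (j, true)] := by
    rw [isReduced_cons_cons]
    exact ⟨fun h => absurd h hij, IsReduced.singleton⟩
  have e1 : (of j)⁻¹ * of i = mk [(j, false), (i, true)] := rfl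
  have e2 : (of i)⁻¹ * of j = mk [(i, false), (j, true)] := rfl
  have e3 : of i = mk [(i, true)] := rfl
  have n1 : ((of i)⁻¹ * of j).norm = 2 := by
    rw [e2, norm, toWord_mk_of_isReduced hred']; rfl
  have d1 : (of j)⁻¹ * of i ≠ 1 := by
    rw [Ne, ← toWord_eq_nil_iff, e1, toWord_mk_of_isReduced hred]; simp
  have d2 : of i ≠ 1 := of_ne_one i
  have d3 : (of j)⁻¹ * of i ≠ of i := by simp [of_ne_one]
  have p1 : parent ((of j)⁻¹ * of i) = of i := by rw [e1, parent_mk_cons hred]; rfl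
  have p2 : parent (of i) = 1 := by rw [e3, parent_mk_cons IsReduced.singleton]; rfl
  rw [← rootedDiff_pow_norm, deformedTranslation_rootedDiff]
  funext x
  by_cases hx : x ∈ suffixes ((of i)⁻¹ * of j)⁻¹
  · have hx' : x = 1 ∨ x = of i ∨ x = (of j)⁻¹ * of i := by
      rw [mem_suffixes, mul_inv_rev, inv_inv, e1, toWord_mk_of_isReduced hred,
        List.suffix_cons_iff, List.suffix_cons_iff, List.suffix_nil] at hx
      rcases hx with hx | hx | hx
      · right; right
        rw [← mk_toWord (x := x), hx, e1]
      · right; left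
        rw [← mk_toWord (x := x), hx, e3]
      · left
        rwa [toWord_eq_nil_iff] at hx
    rcases hx' with rfl | rfl | rfl
    · simp [rootedDiff_apply, translation_apply, n1, d1.symm, d2.symm]
    · simp [rootedDiff_apply, translation_apply, n1, d3.symm, d2, p2]
      ring
    · simp [rootedDiff_apply, translation_apply, d3, d1, p1]
      ring
  · rw [rootedDiff_translation _ _ hx, rootedDiff_pow_norm,
      Pi.single_eq_of_ne (mul_ne_one_of_notMem_suffixes hx)]
    have m : ∀ y ∈ suffixes ((of i)⁻¹ * of j)⁻¹, x ≠ y := fun y hy h => hx (h ▸ hy)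
    have m1 : x ≠ 1 := m _ (one_mem_suffixes _)
    have m2 : x ≠ (of j)⁻¹ * of i := m _ (by
      have := self_mem_suffixes ((of i)⁻¹ * of j)⁻¹
      rwa [mul_inv_rev, inv_inv] at this ⊢)
    have m3 : x ≠ of i := m _ (by
      rw [mem_suffixes, mul_inv_rev, inv_inv, e1, toWord_mk_of_isReduced hred, toWord_of]
      exact List.suffix_cons _ _)
    simp [m1, m2, m3]

end RootedDifference

end FreeGroup

/-! ### Operators and functionals on square-summable families -/

section SquareSummable
open scoped ENNReal lp

theorem two_toReal_pos : 0 < (2 : ℝ≥0∞).toReal := by simp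

theorem lp_two_sum_le {ι : Type*} {E : ι → Type*} [∀ i, NormedAddCommGroup (E i)] (f : lp E 2)
    (s : Finset ι) : ∑ x ∈ s, ‖f x‖ ^ 2 ≤ ‖f‖ ^ 2 := by
  simpa using lp.sum_rpow_le_norm_rpow two_toReal_pos f s

theorem memlp_two_of_sum_le {ι : Type*} {E : ι → Type*} [∀ i, NormedAddCommGroup (E i)]
    {f : ∀ i, E i} {C : ℝ} (h : ∀ s : Finset ι, ∑ x ∈ s, ‖f x‖ ^ 2 ≤ C) : Memℓp f 2 :=
  memℓp_gen' (C := C) fun s => by simpa using h s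

theorem lp_two_norm_le {ι : Type*} {E : ι → Type*} [∀ i, NormedAddCommGroup (E i)]
    {f : lp E 2} {C : ℝ} (hC : 0 ≤ C) (h : ∀ s : Finset ι, ∑ x ∈ s, ‖f x‖ ^ 2 ≤ C ^ 2) :
    ‖f‖ ≤ C :=
  lp.norm_le_of_forall_sum_le two_toReal_pos hC fun s => by simpa using h s

theorem lp_two_sum_le_of_exists {ι : Type*} {T : (ι → ℂ) → ι → ℂ} {K : ℝ}
    (hT : ∀ f (s : Finset ι), ∃ t : Finset ι, ∑ x ∈ s, ‖T f x‖ ^ 2 ≤ K ^ 2 * ∑ x ∈ t, ‖f x‖ ^ 2)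
    (f : ℓ²(ι, ℂ)) (s : Finset ι) : ∑ x ∈ s, ‖T f x‖ ^ 2 ≤ (K * ‖f‖) ^ 2 := by
  obtain ⟨t, ht⟩ := hT f s
  rw [mul_pow]
  exact ht.trans (mul_le_mul_of_nonneg_left (lp_two_sum_le f t) (sq_nonneg K))

/-- A representation on functions which is bounded in the `ℓ²` sense restricts to `ℓ²`. -/
noncomputable def squareSummableRep {G ι : Type*} [Group G]
    (ρ : G →* Module.End ℂ (ι → ℂ)) {K : ℝ} (hK : 0 ≤ K)
    (hρ : ∀ g f (s : Finset ι), ∃ t : Finset ι,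
      ∑ x ∈ s, ‖ρ g f x‖ ^ 2 ≤ K ^ 2 * ∑ x ∈ t, ‖f x‖ ^ 2) :
    G →* (ℓ²(ι, ℂ) →L[ℂ] ℓ²(ι, ℂ))ˣ :=
  MonoidHom.toHomUnits
    { toFun := fun g => LinearMap.mkContinuous
        { toFun := fun f => ⟨ρ g f, memlp_two_of_sum_le (lp_two_sum_le_of_exists (hρ g) f)⟩
          map_add' := fun f h => lp.ext (map_add (ρ g) (f : ι → ℂ) h)
          map_smul' := fun c f => lp.ext (map_smul (ρ g) c (f : ι → ℂ)) } K
        fun f => lp_two_norm_le (by positivity) (lp_two_sum_le_of_exists (hρ g) f)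
      map_one' := by
        ext f x
        simp
      map_mul' := fun g h => by
        ext f x
        simp }

theorem squareSummableRep_apply {G ι : Type*} [Group G]
    (ρ : G →* Module.End ℂ (ι → ℂ)) {K : ℝ} (hK : 0 ≤ K)
    (hρ : ∀ g f (s : Finset ι), ∃ t : Finset ι,
      ∑ x ∈ s, ‖ρ g f x‖ ^ 2 ≤ K ^ 2 * ∑ x ∈ t, ‖f x‖ ^ 2) (g : G) (f : ℓ²(ι, ℂ)) :
    (((squareSummableRep ρ hK hρ g : ℓ²(ι, ℂ) →L[ℂ] ℓ²(ι, ℂ)) f : ℓ²(ι, ℂ)) : ι → ℂ) =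
      ρ g f := rfl

theorem isUniformlyBounded_squareSummableRep {G : Type u} {ι : Type v} [Group G]
    (ρ : G →* Module.End ℂ (ι → ℂ)) {K : ℝ} (hK : 0 ≤ K)
    (hρ : ∀ g f (s : Finset ι), ∃ t : Finset ι,
      ∑ x ∈ s, ‖ρ g f x‖ ^ 2 ≤ K ^ 2 * ∑ x ∈ t, ‖f x‖ ^ 2) :
    IsUniformlyBounded (squareSummableRep ρ hK hρ) :=
  ⟨K, fun g => ContinuousLinearMap.opNorm_le_bound _ hK fun f =>
    lp_two_norm_le (by positivity) (lp_two_sum_le_of_exists (hρ g) f)⟩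

/-- By the Riesz representation the values are governed by the coordinates of a square-summable
vector along distinct indices. -/
theorem tendsto_apply_single {ι : Type*} [DecidableEq ι] (φ : StrongDual ℂ ℓ²(ι, ℂ)) {x : ℕ → ι}
    (hx : Function.Injective x) (c : ℂ) :
    Filter.Tendsto (fun k => φ (lp.single 2 (x k) c)) Filter.atTop (nhds 0) := by
  set y := (InnerProductSpace.toDual ℂ ℓ²(ι, ℂ)).symm φ with hy
  have e : ∀ i, φ (lp.single 2 i c) = inner ℂ (y i) c := fun i => by
    rw [← lp.inner_single_right, hy, InnerProductSpace.toDual_symm_apply]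
  have h1 : Summable fun i => ‖y i‖ ^ 2 := by
    simpa using (lp.memℓp y).summable two_toReal_pos
  have h2 : Filter.Tendsto (fun k => ‖y (x k)‖) Filter.atTop (nhds 0) := by
    have := (h1.tendsto_cofinite_zero.comp hx.tendsto_cofinite)
    rw [Nat.cofinite_eq_atTop] at this
    have h3 := this.sqrt
    simpa using h3
  rw [tendsto_zero_iff_norm_tendsto_zero]
  refine squeeze_zero (fun _ => norm_nonneg _) (fun k => ?_) (g := fun k => ‖y (x k)‖ * ‖c‖) ?_
  · rw [e]
    exact norm_inner_le_norm _ _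
  · simpa using h2.mul_const ‖c‖

end SquareSummable

/-! ### The mean-zero projection on three-dimensional `ℓ^p` -/

section CenteringMatrix

theorem strictConvexOn_norm_rpow {E : Type*} [NormedAddCommGroup E] [NormedSpace ℝ E]
    [StrictConvexSpace ℝ E] {p : ℝ} (hp : 1 < p) :
    StrictConvexOn ℝ Set.univ (fun x : E => ‖x‖ ^ p) := by
  refine ⟨convex_univ, fun x _ y _ hxy a b ha hb hab => ?_⟩
  have hp0 : 0 < p := by linarith
  by_cases h : ‖x‖ = ‖y‖
  · have h1 := norm_combo_lt_of_ne le_rfl h.ge hxy ha hb hab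
    have h2 := Real.rpow_lt_rpow (norm_nonneg _) h1 hp0
    simp only [smul_eq_mul, ← h, ← add_mul, hab, one_mul]
    exact h2
  · have h1 : ‖a • x + b • y‖ ≤ a * ‖x‖ + b * ‖y‖ := by
      refine (norm_add_le _ _).trans (le_of_eq ?_)
      rw [norm_smul, norm_smul, Real.norm_of_nonneg ha.le, Real.norm_of_nonneg hb.le]
    refine (Real.rpow_le_rpow (norm_nonneg _) h1 hp0.le).trans_lt ?_
    exact (strictConvexOn_rpow hp).2 (norm_nonneg x) (norm_nonneg y) h ha hb hab

/-- The orthogonal projection of `ℂ³` onto the vectors of mean zero. -/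
noncomputable def centering : Matrix (Fin 3) (Fin 3) ℂ :=
  Matrix.of fun i j => if i = j then 2 / 3 else -(1 / 3)

/-- Each row has absolute sum `4/3`, so it is `4/3` times an average of signed coordinates. Jensen's
inequality, with weights that are doubly stochastic, gives the bound; strict convexity excludes
equality. -/
theorem sum_centering_lt {p : ℝ} (hp : 1 < p) {s : Fin 3 → ℂ} (hs : s ≠ 0) :
    ∑ i, ‖∑ j, centering i j * s j‖ ^ p < (4 / 3) ^ p * ∑ k, ‖s k‖ ^ p := by
  set w : Fin 3 → Fin 3 → ℝ := fun i j => if i = j then 1 / 2 else 1 / 4 with hw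
  set q : Fin 3 → Fin 3 → ℂ := fun i j => if i = j then s j else -s j with hq
  have hw0 : ∀ i j, 0 < w i j := fun i j => by simp only [hw]; split_ifs <;> norm_num
  have hw1 : ∀ i, ∑ j, w i j = 1 := fun i => by
    fin_cases i <;> simp [hw, Fin.sum_univ_three] <;> norm_num
  have e : ∀ i, ‖∑ j, centering i j * s j‖ ^ p = (4 / 3) ^ p * ‖∑ j, w i j • q i j‖ ^ p := by
    intro i
    have : ∑ j, centering i j * s j = ((4 / 3 : ℝ) : ℂ) * ∑ j, w i j • q i j := by
      rw [Finset.mul_sum]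
      refine Finset.sum_congr rfl fun j _ => ?_
      simp only [centering, Matrix.of_apply, hw, hq, Complex.real_smul]
      split_ifs <;> push_cast <;> ring
    rw [this, norm_mul, Real.mul_rpow (norm_nonneg _) (norm_nonneg _), Complex.norm_real,
      Real.norm_of_nonneg (by norm_num)]
  have hle : ∀ i, ‖∑ j, w i j • q i j‖ ^ p ≤ ∑ j, w i j * ‖s j‖ ^ p := by
    intro i
    have := (strictConvexOn_norm_rpow (E := ℂ) hp).convexOn.map_sum_le (t := Finset.univ)
      (w := w i) (p := q i) (fun j _ => (hw0 i j).le) (hw1 i) (fun _ _ => Set.mem_univ _)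
    refine this.trans (le_of_eq (Finset.sum_congr rfl fun j _ => ?_))
    simp only [hq, smul_eq_mul]
    split_ifs <;> simp
  have hsum : ∑ i, ∑ j, w i j * ‖s j‖ ^ p = ∑ k, ‖s k‖ ^ p := by
    simp [hw, Fin.sum_univ_three]
    ring
  simp_rw [e]
  rw [← Finset.mul_sum]
  refine mul_lt_mul_of_pos_left ?_ (by positivity)
  rw [← hsum]
  refine Finset.sum_lt_sum (fun i _ => hle i) ?_
  by_contra! hc
  -- Equality in Jensen makes the signed coordinates constant along each row; the sign patterns of
  -- two rows are incompatible unless `s = 0`.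
  have hcon : ∀ i j k, q i j = q i k := by
    intro i j k
    refine (strictConvexOn_norm_rpow (E := ℂ) hp).eq_of_le_map_sum (t := Finset.univ)
      (w := w i) (p := q i) (fun j _ => hw0 i j) (hw1 i) (fun _ _ => Set.mem_univ _) ?_
      (Finset.mem_univ j) (Finset.mem_univ k)
    refine le_trans (le_of_eq (Finset.sum_congr rfl fun j _ => ?_)) (hc i (Finset.mem_univ i))
    simp only [hq, smul_eq_mul]
    split_ifs <;> simp
  have a1 := hcon 0 0 1
  have a2 := hcon 0 0 2
  have a3 := hcon 1 0 2
  simp [hq] at a1 a2 a3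
  apply hs
  have b0 : s 0 = 0 := by linear_combination (1 / 2) * a2 + (1 / 2) * a3
  funext i
  fin_cases i
  · exact b0
  · simpa [b0] using a1
  · simpa [b0] using a2

theorem exists_sum_centering_le {p : ℝ} (hp : 1 < p) : ∃ K : ℝ, 0 < K ∧ K < 4 / 3 ∧
    ∀ s : Fin 3 → ℂ, ∑ i, ‖∑ j, centering i j * s j‖ ^ p ≤ K ^ p * ∑ k, ‖s k‖ ^ p := by
  have hp0 : 0 < p := by linarith
  have hc : ∀ f : Fin 3 → (Fin 3 → ℂ) → ℂ, (∀ i, Continuous (f i)) →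
      Continuous fun s => ∑ i, ‖f i s‖ ^ p := fun f hf =>
    continuous_finsetSum _ fun i _ => (hf i).norm.rpow_const fun _ => Or.inr hp0.le
  have hnum := hc (fun i s => ∑ j, centering i j * s j) (fun i => by fun_prop)
  have hden := hc (fun i s => s i) (fun i => by fun_prop)
  have hpos : ∀ s : Fin 3 → ℂ, s ≠ 0 → 0 < ∑ k, ‖s k‖ ^ p := by
    intro s hs
    obtain ⟨i, hi⟩ := Function.ne_iff.1 hs
    exact Finset.sum_pos' (fun _ _ => by positivity)
      ⟨i, Finset.mem_univ i, Real.rpow_pos_of_pos (norm_pos_iff.2 hi) p⟩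
  obtain ⟨m, hm, hmax⟩ := (isCompact_sphere (0 : Fin 3 → ℂ) 1).exists_isMaxOn
    (NormedSpace.sphere_nonempty.2 zero_le_one)
    (f := fun s => (∑ i, ‖∑ j, centering i j * s j‖ ^ p) / ∑ k, ‖s k‖ ^ p)
    (hnum.continuousOn.div hden.continuousOn fun s hs =>
      (hpos s (ne_zero_of_mem_unit_sphere ⟨s, hs⟩)).ne')
  have hm0 : m ≠ 0 := ne_zero_of_mem_unit_sphere ⟨m, hm⟩
  set R := (∑ i, ‖∑ j, centering i j * m j‖ ^ p) / ∑ k, ‖m k‖ ^ p with hR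
  have hR0 : 0 ≤ R := by positivity
  have hR1 : R < (4 / 3) ^ p := (div_lt_iff₀ (hpos m hm0)).2 (sum_centering_lt hp hm0)
  -- The maximum with `1` only serves to make the constant visibly positive.
  refine ⟨max (R ^ p⁻¹) 1, by positivity, max_lt ?_ (by norm_num), fun s => ?_⟩
  · rwa [Real.rpow_inv_lt_iff_of_pos hR0 (by norm_num) hp0]
  have hRK : R ≤ (max (R ^ p⁻¹) 1) ^ p :=
    calc R = (R ^ p⁻¹) ^ p := (Real.rpow_inv_rpow hR0 hp0.ne').symm
      _ ≤ _ := Real.rpow_le_rpow (by positivity) (le_max_left _ _) hp0.le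
  by_cases hs : s = 0
  · simp [hs, Real.zero_rpow hp0.ne']
  refine le_trans ?_ (mul_le_mul_of_nonneg_right hRK (hpos s hs).le)
  have hs' : 0 < ‖s‖ := norm_pos_iff.2 hs
  have h1 : ((‖s‖⁻¹ : ℝ) : ℂ) • s ∈ Metric.sphere (0 : Fin 3 → ℂ) 1 := by
    rw [mem_sphere_zero_iff_norm, norm_smul, Complex.norm_real, norm_inv, norm_norm,
      inv_mul_cancel₀ hs'.ne']
  have h2 := hmax h1
  simp only [Set.mem_ofPred_eq, Pi.smul_apply, smul_eq_mul] at h2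
  have e1 : ∀ f : Fin 3 → ℂ, ∑ i, ‖((‖s‖⁻¹ : ℝ) : ℂ) * f i‖ ^ p = (‖s‖⁻¹) ^ p * ∑ i, ‖f i‖ ^ p := by
    intro f
    rw [Finset.mul_sum]
    refine Finset.sum_congr rfl fun i _ => ?_
    rw [norm_mul, Complex.norm_real, norm_inv, norm_norm,
      Real.mul_rpow (by positivity) (by positivity)]
  have e2 : ∀ i, ∑ j, centering i j * (((‖s‖⁻¹ : ℝ) : ℂ) * s j) =
      ((‖s‖⁻¹ : ℝ) : ℂ) * ∑ j, centering i j * s j := fun i => by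
    rw [Finset.mul_sum]
    exact Finset.sum_congr rfl fun j _ => by ring
  simp_rw [e2] at h2
  rw [e1, e1, mul_div_mul_left _ _ (by positivity), div_le_iff₀ (hpos s hs)] at h2
  exact h2

end CenteringMatrix

/-! ### Invariant `p`-norms and the centering inequality -/

section PNorm

theorem IsPNorm.sum_le {p : ℝ} {X : Type v} [AddCommGroup X] [Module ℂ X]
    {N : Seminorm ℂ X} (hN : IsPNorm p N) {n : ℕ} {M : Matrix (Fin n) (Fin n) ℂ} {K : ℝ}
    (hK : 0 < K) (hM : ∀ s : Fin n → ℂ, ∑ i, ‖∑ j, M i j * s j‖ ^ p ≤ K ^ p * ∑ k, ‖s k‖ ^ p)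
    (x : Fin n → X) : ∑ i, N (∑ j, M i j • x j) ^ p ≤ K ^ p * ∑ k, N (x k) ^ p := by
  have hKn : ‖((K⁻¹ : ℝ) : ℂ)‖ = K⁻¹ := by
    rw [Complex.norm_real, Real.norm_of_nonneg (by positivity)]
  have hKp : 0 < K ^ p := Real.rpow_pos_of_pos hK p
  have h := hN n (((K⁻¹ : ℝ) : ℂ) • M) (fun s => by
    have e : ∀ i, ‖∑ j, (((K⁻¹ : ℝ) : ℂ) • M) i j * s j‖ ^ p =
        (K ^ p)⁻¹ * ‖∑ j, M i j * s j‖ ^ p := fun i => by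
      simp only [Matrix.smul_apply, smul_eq_mul, mul_assoc]
      rw [← Finset.mul_sum, norm_mul, hKn, Real.mul_rpow (by positivity) (norm_nonneg _),
        Real.inv_rpow hK.le]
    simp_rw [e]
    rw [← Finset.mul_sum, inv_mul_le_iff₀ hKp]
    exact hM s) x
  have e : ∀ i, N (∑ j, (((K⁻¹ : ℝ) : ℂ) • M) i j • x j) ^ p =
      (K ^ p)⁻¹ * N (∑ j, M i j • x j) ^ p := fun i => by
    simp only [Matrix.smul_apply, smul_eq_mul, mul_smul]
    rw [← Finset.smul_sum, map_smul_eq_mul, hKn, Real.mul_rpow (by positivity) (apply_nonneg _ _),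
      Real.inv_rpow hK.le]
  simp_rw [e] at h
  rwa [← Finset.mul_sum, inv_mul_le_iff₀ hKp] at h

/-- Hahn–Banach for the seminormed structure defined by `N` itself. -/
theorem Seminorm.exists_dual_eq {X : Type*} [AddCommGroup X] [Module ℂ X] (N : Seminorm ℂ X)
    (x : X) : ∃ φ : Module.Dual ℂ X, φ x = N x ∧ ∀ y, ‖φ y‖ ≤ N y := by
  let : SeminormedAddCommGroup X := N.toAddGroupSeminorm.toSeminormedAddCommGroup
  let : NormedSpace ℂ X := ⟨fun a b => (map_smul_eq_mul N a b).le⟩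
  obtain ⟨g, hg, hgx⟩ := exists_dual_vector'' ℂ x
  refine ⟨g.toLinearMap, hgx, fun y => ?_⟩
  exact (g.le_opNorm y).trans (mul_le_of_le_one_left (norm_nonneg y) hg)

/-- A group acting by isometries of a `p`-norm satisfies the inequality of the matrix
`centering` for the translates of a vector. -/
theorem IsPNorm.sum_centering_le {p K : ℝ} (hp : 1 < p) {X : Type v} [NormedAddCommGroup X]
    [NormedSpace ℂ X] {N : Seminorm ℂ X} (hN : IsPNorm p N) (hK : 0 < K)
    (hM : ∀ s : Fin 3 → ℂ, ∑ i, ‖∑ j, centering i j * s j‖ ^ p ≤ K ^ p * ∑ k, ‖s k‖ ^ p)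
    {G : Type u} [Group G] (π : G →* (X →L[ℂ] X)ˣ)
    (hπ : ∀ (g : G) (x : X), N ((π g : X →L[ℂ] X) x) = N x) (g : Fin 3 → G) (e : X)
    (φ : Module.Dual ℂ X) (hφ : ∀ y, ‖φ y‖ ≤ N y) :
    ‖∑ i, ∑ j, centering i j * φ ((π ((g i)⁻¹ * g j) : X →L[ℂ] X) e)‖ ≤ 3 * K * N e := by
  have hp0 : 0 < p := by linarith
  set y : Fin 3 → X := fun i => ∑ j, centering i j • (π (g j) : X →L[ℂ] X) e with hy
  have h1 := hN.sum_le hK hM (fun j => (π (g j) : X →L[ℂ] X) e)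
  simp only [hπ, Finset.sum_const, Finset.card_univ, Fintype.card_fin, nsmul_eq_mul,
    Nat.cast_ofNat] at h1
  have h2 : ∑ i, N (y i) ≤ 3 * K * N e := by
    -- The power mean inequality costs `3 ^ (1 - 1/p)`, and the three vectors of equal norm
    -- contribute `3 ^ (1/p)`: together the factor `3`.
    have h3 := Real.rpow_sum_le_const_mul_sum_rpow_of_nonneg Finset.univ hp.le
      (f := fun i => N (y i)) (fun i _ => apply_nonneg N _)
    simp only [Finset.card_univ, Fintype.card_fin, Nat.cast_ofNat] at h3
    have h4 : (∑ i, N (y i)) ^ p ≤ (3 * K * N e) ^ p := by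
      refine h3.trans ((mul_le_mul_of_nonneg_left h1 (by positivity)).trans (le_of_eq ?_))
      rw [Real.mul_rpow (by positivity) (apply_nonneg N _), Real.mul_rpow (by norm_num) hK.le,
        Real.rpow_sub_one (by norm_num)]
      field_simp
    exact (Real.rpow_le_rpow_iff (Finset.sum_nonneg fun i _ => apply_nonneg N _)
      (by have := apply_nonneg N e; positivity) hp0).1 h4
  refine le_trans (norm_sum_le _ _) (le_trans (Finset.sum_le_sum fun i _ => ?_) h2)
  have h5 : ∑ j, centering i j * φ ((π ((g i)⁻¹ * g j) : X →L[ℂ] X) e) =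
      φ ((π (g i)⁻¹ : X →L[ℂ] X) (y i)) := by
    simp only [hy, map_sum, map_smul, smul_eq_mul, map_mul, Units.val_mul,
      mul_apply_eq_comp]
  rw [h5]
  exact (hφ _).trans (hπ _ _).le

end PNorm

/-! ### Hilbert spaces are `p`-spaces -/

section HilbertSpace

open MeasureTheory

theorem exists_unitaryInvariant_measure (W : Type*) [NormedAddCommGroup W] [InnerProductSpace ℂ W]
    [FiniteDimensional ℂ W] [MeasurableSpace W] [BorelSpace W] :
    ∃ μ : Measure W, IsFiniteMeasureOnCompacts μ ∧ μ.IsOpenPosMeasure ∧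
      ∀ U : W ≃ₗᵢ[ℂ] W, MeasurePreserving U μ μ := by
  let : InnerProductSpace ℝ W := InnerProductSpace.rclikeToReal ℂ W
  have : FiniteDimensional ℝ W := FiniteDimensional.complexToReal W
  refine ⟨volume, inferInstance, inferInstance, fun U => ?_⟩
  let V : W ≃ₗᵢ[ℝ] W := ⟨U.toLinearEquiv.restrictScalars ℝ, U.norm_map⟩
  exact V.measurePreserving

theorem exists_linearIsometryEquiv_apply_eq {W : Type*} [NormedAddCommGroup W]
    [InnerProductSpace ℂ W] [FiniteDimensional ℂ W] {x y : W} (hx : ‖x‖ = 1) (hy : ‖y‖ = 1) :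
    ∃ U : W ≃ₗᵢ[ℂ] W, U x = y := by
  let L := (LinearIsometry.toSpanSingleton ℂ W hy).comp
    (LinearIsometryEquiv.toSpanUnitSingleton x hx).symm.toLinearIsometry
  refine ⟨L.extend.toLinearIsometryEquiv rfl, ?_⟩
  have h : (LinearIsometryEquiv.toSpanUnitSingleton (𝕜 := ℂ) x hx).symm
      ⟨x, Submodule.mem_span_singleton_self x⟩ = 1 := by
    rw [LinearIsometryEquiv.symm_apply_eq]
    ext
    simp
  refine (L.extend_apply ⟨x, Submodule.mem_span_singleton_self x⟩).trans ?_
  simp [L, h]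

/-- The norm of a finite-dimensional Hilbert space is that of a space of `p`-integrable
functions. -/
theorem exists_norm_rpow_eq_integral (W : Type*) [NormedAddCommGroup W] [InnerProductSpace ℂ W]
    [FiniteDimensional ℂ W] [MeasurableSpace W] [BorelSpace W] {p : ℝ} (hp : 0 < p) :
    ∃ (μ : Measure W) (w : W → ℝ) (c : ℝ), 0 < c ∧ (∀ v, 0 ≤ w v) ∧
      (∀ x : W, Integrable (fun v => w v * ‖inner ℂ v x‖ ^ p) μ) ∧
      ∀ x : W, ∫ v, w v * ‖inner ℂ v x‖ ^ p ∂μ = c * ‖x‖ ^ p := by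
  obtain ⟨μ, hμ1, hμ2, hU⟩ := exists_unitaryInvariant_measure W
  have : ProperSpace W := FiniteDimensional.proper ℂ W
  -- A compactly supported radial weight: integrals are finite and unitary invariance is kept.
  set w : W → ℝ := fun v => max 0 (1 - ‖v‖) with hw
  have hwc : HasCompactSupport w := by
    refine HasCompactSupport.intro (isCompact_closedBall (0 : W) 1) fun v hv => ?_
    rw [mem_closedBall_zero_iff, not_le] at hv
    exact max_eq_left (by linarith)
  have hcont : ∀ x : W, Continuous fun v => w v * ‖inner ℂ v x‖ ^ p := fun x =>
    Continuous.mul (by fun_prop)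
      (Continuous.rpow_const (by fun_prop) fun _ => Or.inr hp.le)
  have hint : ∀ x : W, Integrable (fun v => w v * ‖inner ℂ v x‖ ^ p) μ := fun x =>
    (hcont x).integrable_of_hasCompactSupport hwc.mul_right
  have hw0 : ∀ v, 0 ≤ w v := fun v => le_max_left _ _
  have hsmul : ∀ (a : ℂ) (x : W), ∫ v, w v * ‖inner ℂ v (a • x)‖ ^ p ∂μ =
      ‖a‖ ^ p * ∫ v, w v * ‖inner ℂ v x‖ ^ p ∂μ := fun a x => by
    rw [← integral_const_mul]
    refine integral_congr_ae (Filter.Eventually.of_forall fun v => ?_)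
    simp only [inner_smul_right, norm_mul, Real.mul_rpow (norm_nonneg _) (norm_nonneg _)]
    ring
  rcases subsingleton_or_nontrivial W with hs | hs
  · refine ⟨μ, w, 1, one_pos, hw0, hint, fun x => ?_⟩
    rw [Subsingleton.elim x 0]
    simp [Real.zero_rpow hp.ne']
  obtain ⟨e, he⟩ := exists_norm_eq W zero_le_one
  refine ⟨μ, w, ∫ v, w v * ‖inner ℂ v e‖ ^ p ∂μ, ?_, hw0, hint, fun x => ?_⟩
  · refine (hcont e).integral_pos_of_hasCompactSupport_nonneg_nonzero hwc.mul_right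
      (x := (1 / 2 : ℂ) • e) (fun v => mul_nonneg (hw0 v) (by positivity)) ?_
    have h1 : w ((1 / 2 : ℂ) • e) = 1 / 2 := by
      simp only [hw, norm_smul, he]
      norm_num
    have h2 : inner ℂ ((1 / 2 : ℂ) • e) e = (1 / 2 : ℂ) := by
      rw [inner_smul_left, inner_self_eq_norm_sq_to_K, he]
      simp [map_ofNat]
    rw [h1, h2]
    have : 0 < ‖(1 / 2 : ℂ)‖ ^ p := Real.rpow_pos_of_pos (by norm_num) p
    positivity
  · by_cases hx : x = 0
    · simp [hx, Real.zero_rpow hp.ne']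
    have hx0 : ‖x‖ ≠ 0 := norm_ne_zero_iff.2 hx
    obtain ⟨U, hUx⟩ := exists_linearIsometryEquiv_apply_eq (x := ((‖x‖⁻¹ : ℝ) : ℂ) • x) (y := e)
      (by rw [norm_smul, Complex.norm_real, norm_inv, norm_norm, inv_mul_cancel₀ hx0]) he
    have h1 : x = ((‖x‖ : ℝ) : ℂ) • ((‖x‖⁻¹ : ℝ) : ℂ) • x := by
      rw [smul_smul, ← Complex.ofReal_mul, mul_inv_cancel₀ hx0, Complex.ofReal_one, one_smul]
    conv_lhs => rw [h1, hsmul, Complex.norm_real, norm_norm]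
    have h2 := (hU U).integral_comp U.toHomeomorph.measurableEmbedding
      fun v => w v * ‖inner ℂ v e‖ ^ p
    rw [← h2, mul_comm]
    congr 1
    refine integral_congr_ae (Filter.Eventually.of_forall fun v => ?_)
    simp only [← hUx, LinearIsometryEquiv.inner_map_map, hw, LinearIsometryEquiv.norm_map]

/-- The scalar inequality holds pointwise for the numbers `⟨v, x j⟩` and is integrated over `v`. -/
theorem isPNorm_of_finiteDimensional {p : ℝ} (hp : 0 < p) (W : Type*) [NormedAddCommGroup W]
    [InnerProductSpace ℂ W] [FiniteDimensional ℂ W] : IsPNorm p (normSeminorm ℂ W) := by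
  intro n M hM x
  let : MeasurableSpace W := borel W
  have : BorelSpace W := ⟨rfl⟩
  obtain ⟨μ, w, c, hc, hw, hint, heq⟩ := exists_norm_rpow_eq_integral W hp
  refine le_of_mul_le_mul_left ?_ hc
  simp only [coe_normSeminorm, Finset.mul_sum, ← heq]
  rw [← integral_finsetSum _ fun i _ => hint _, ← integral_finsetSum _ fun i _ => hint _]
  refine integral_mono (integrable_finsetSum _ fun i _ => hint _)
    (integrable_finsetSum _ fun i _ => hint _) fun v => ?_
  simp only [← Finset.mul_sum, inner_sum, inner_smul_right]
  exact mul_le_mul_of_nonneg_left (hM fun j => inner ℂ v (x j)) (hw v)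

/-- Hilbert spaces are `p`-spaces for every `p`. -/
theorem isPSpace_of_innerProductSpace {p : ℝ} (hp : 0 < p) (H : Type*) [NormedAddCommGroup H]
    [InnerProductSpace ℂ H] [CompleteSpace H] : IsPSpace p H := by
  refine ⟨inferInstance, fun n M hM x => ?_⟩
  have : FiniteDimensional ℂ (Submodule.span ℂ (Set.range x)) :=
    FiniteDimensional.span_of_finite ℂ (Set.finite_range x)
  have h := isPNorm_of_finiteDimensional hp (Submodule.span ℂ (Set.range x)) n M hM
    fun j => ⟨x j, Submodule.subset_span ⟨j, rfl⟩⟩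
  simpa using h

end HilbertSpace

/-! ### The deformed representation is not `p`-isometrisable -/

section DeformedRepresentation
open scoped lp
open FreeGroup

theorem exists_uniformlyBounded_not_isIsometrisableRep {p : ℝ} (hp : 1 < p) :
    ∃ π : FreeGroup ℤ →* (ℓ²(FreeGroup ℤ, ℂ) →L[ℂ] ℓ²(FreeGroup ℤ, ℂ))ˣ,
      IsUniformlyBounded π ∧ ¬ IsIsometrisableRep p π := by
  obtain ⟨K, hK0, hK, hM⟩ := exists_sum_centering_le hp
  -- `K < 4/3` gives both `t < 1` and `2 + 2 t² > 3 K`, the latter being the final contradiction.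
  set t : ℝ := √(3 * K / 4) with ht
  have ht2 : t ^ 2 = 3 * K / 4 := Real.sq_sqrt (by positivity)
  set z : ℂ := t * Complex.I with hz
  have hz2 : z ^ 2 = ((-(3 * K / 4) : ℝ) : ℂ) := by
    rw [hz, mul_pow, Complex.I_sq, ← Complex.ofReal_pow, ht2]
    push_cast
    ring
  have hz1 : ‖z‖ < 1 := by
    rw [hz, norm_mul, Complex.norm_I, mul_one, Complex.norm_real,
      Real.norm_of_nonneg (Real.sqrt_nonneg _), ← sq_lt_one_iff₀ (Real.sqrt_nonneg _), ht2]
    linarith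
  have hC : 0 ≤ 2 / (1 - ‖z‖) := div_nonneg zero_le_two (by linarith)
  refine ⟨squareSummableRep (deformedTranslation (X := ℤ) z) hC (exists_sum_deformedTranslation_le hz1),
    isUniformlyBounded_squareSummableRep _ _ _, ?_⟩
  rintro ⟨N, ⟨c, C, hc, hcC⟩, hN, hinv⟩
  set π := squareSummableRep (deformedTranslation (X := ℤ) z) hC (exists_sum_deformedTranslation_le hz1)
    with hπ
  set e : ℓ²(FreeGroup ℤ, ℂ) := lp.single 2 (1 : FreeGroup ℤ) (1 : ℂ) with he
  have hNe : 0 < N e := by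
    refine lt_of_lt_of_le ?_ (hcC e).1
    rw [he, lp.norm_single (by norm_num)]
    simpa using hc
  obtain ⟨φ₀, hφe, hφ⟩ := N.exists_dual_eq e
  set φ : StrongDual ℂ ℓ²(FreeGroup ℤ, ℂ) :=
    φ₀.mkContinuous C fun y => (hφ y).trans (hcC y).2 with hφdef
  have hφ' : ∀ y, φ₀ y = φ y := fun _ => rfl
  have hw : ∀ i j : ℤ, i ≠ j → φ₀ ((π ((of i)⁻¹ * of j) : _ →L[ℂ] _) e) = z ^ 2 * N e +
      φ (lp.single 2 (of i) (z - z ^ 3 : ℂ)) +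
        φ (lp.single 2 ((of j)⁻¹ * of i) (1 - z ^ 2 : ℂ)) := by
    intro i j hij
    have h1 : (π ((of i)⁻¹ * of j) : _ →L[ℂ] _) e = z ^ 2 • e +
        lp.single 2 (of i) (z - z ^ 3 : ℂ) + lp.single 2 ((of j)⁻¹ * of i) (1 - z ^ 2 : ℂ) := by
      rw [he, ← lp.single_smul]
      apply lp.ext
      rw [hπ, squareSummableRep_apply, lp.coeFn_single, deformedTranslation_single_one z hij]
      simp only [lp.coeFn_add, lp.coeFn_single, smul_eq_mul, mul_one]
    rw [h1, map_add, map_add, map_smul, hφe, hφ', hφ', smul_eq_mul]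
  have hof : Function.Injective (of : ℤ → FreeGroup ℤ) := of_injective
  -- The indices `3k`, `3k + 1`, `3k + 2` are distinct for each `k` and go to infinity, so the point
  -- masses off `1` die under `φ`.
  have hlim : ∀ i j : Fin 3, Filter.Tendsto
      (fun k : ℕ => φ₀ ((π ((of (3 * k + i : ℤ))⁻¹ * of (3 * k + j : ℤ)) : _ →L[ℂ] _) e))
      Filter.atTop (nhds (if i = j then (N e : ℂ) else z ^ 2 * N e)) := by
    intro i j
    split_ifs with hij
    · subst hij
      simp only [inv_mul_cancel, _root_.map_one, Units.val_one, one_apply_eq_self, hφe]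
      exact tendsto_const_nhds
    · have hij' : (i : ℤ) ≠ j := by exact_mod_cast Fin.val_ne_of_ne hij
      have h1 := tendsto_apply_single φ (x := fun k : ℕ => of (3 * k + i : ℤ))
        (fun a b hab => by have := hof hab; omega) (z - z ^ 3)
      have h2 := tendsto_apply_single φ
        (x := fun k : ℕ => (of (3 * k + j : ℤ))⁻¹ * of (3 * k + i : ℤ))
        (fun a b hab => by
          have h3 : IsReduced [((3 * a + j : ℤ), false), ((3 * a + i : ℤ), true)] := by
            rw [isReduced_cons_cons]
            exact ⟨fun h => absurd h (by simpa using hij'.symm), IsReduced.singleton⟩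
          have h4 : IsReduced [((3 * b + j : ℤ), false), ((3 * b + i : ℤ), true)] := by
            rw [isReduced_cons_cons]
            exact ⟨fun h => absurd h (by simpa using hij'.symm), IsReduced.singleton⟩
          have h5 : (mk [((3 * a + j : ℤ), false), ((3 * a + i : ℤ), true)] : FreeGroup ℤ) =
            mk [((3 * b + j : ℤ), false), ((3 * b + i : ℤ), true)] := hab
          have h6 := congrArg toWord h5
          rw [toWord_mk_of_isReduced h3, toWord_mk_of_isReduced h4] at h6
          simp at h6
          omega) (1 - z ^ 2)
      have h3 := (h1.const_add (z ^ 2 * (N e : ℂ))).add h2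
      simp only [add_zero] at h3
      exact h3.congr fun k => (hw _ _ (by simpa using hij')).symm
  have hsum := tendsto_finsetSum Finset.univ fun i (_ : i ∈ (Finset.univ : Finset (Fin 3))) =>
    tendsto_finsetSum Finset.univ fun j (_ : j ∈ (Finset.univ : Finset (Fin 3))) =>
      (hlim i j).const_mul (centering i j)
  have hle := le_of_tendsto hsum.norm (Filter.Eventually.of_forall fun k =>
    hN.sum_centering_le hp hK0 hM π hinv (fun i => of (3 * k + i : ℤ)) e φ₀ hφ)
  have hval : (∑ i : Fin 3, ∑ j : Fin 3, centering i j *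
      (if i = j then (N e : ℂ) else z ^ 2 * N e)) = (((2 + 3 * K / 2) * N e : ℝ) : ℂ) := by
    rw [hz2]
    simp [Fin.sum_univ_three, centering]
    ring
  rw [hval, Complex.norm_real, Real.norm_of_nonneg (by positivity)] at hle
  have := le_of_mul_le_mul_right hle hNe
  linarith

end DeformedRepresentation

/-! ### Induced representations -/

section Induction

theorem IsIsometrisableRep.of_intertwining {q : ℝ} {G Γ : Type*} [Group G] [Group Γ]
    {X Y : Type*} [NormedAddCommGroup X] [NormedSpace ℂ X] [NormedAddCommGroup Y]
    [NormedSpace ℂ Y] {σ : G →* (X →L[ℂ] X)ˣ} {π : Γ →* (Y →L[ℂ] Y)ˣ}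
    (h : IsIsometrisableRep q π) (T : X →ₗᵢ[ℂ] Y) (k : G → Γ)
    (hT : ∀ g x, (π (k g) : Y →L[ℂ] Y) (T x) = T ((σ g : X →L[ℂ] X) x)) :
    IsIsometrisableRep q σ := by
  obtain ⟨N, ⟨c, C, hc, hcC⟩, hN, hinv⟩ := h
  refine ⟨N.comp T.toLinearMap, ⟨c, C, hc, fun x => ?_⟩, fun n M hM x => ?_, fun g x => ?_⟩
  · simpa using hcC (T x)
  · simpa using hN n M hM fun j => T (x j)
  · simp [← hT, hinv]

/-- The inclusion of a coordinate into a space of square-summable families. -/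
noncomputable def lpSingleIsometry {Q K : Type*} [DecidableEq Q] [NormedAddCommGroup K]
    [NormedSpace ℂ K] (b : Q) : K →ₗᵢ[ℂ] lp (fun _ : Q => K) 2 :=
  ⟨lp.lsingle (𝕜 := ℂ) (E := fun _ : Q => K) 2 b, fun x =>
    lp.norm_single (E := fun _ : Q => K) (by norm_num) b x⟩

theorem lpSingleIsometry_apply {Q K : Type*} [DecidableEq Q] [NormedAddCommGroup K]
    [NormedSpace ℂ K] (b : Q) (v : K) : lpSingleIsometry b v = lp.single 2 b v := rfl

section Cocycle
variable {F Γ K Q : Type*} [Group F] [Group Γ] [MulAction Γ Q] [NormedAddCommGroup K]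
  [NormedSpace ℂ K]

theorem sum_cocycle_le (σ : F →* (K →L[ℂ] K)ˣ) {C : ℝ} (hC : ∀ x, ‖(σ x : K →L[ℂ] K)‖ ≤ C)
    (c : Γ → Q → F) (g : Γ) (f : lp (fun _ : Q => K) 2) (s : Finset Q) :
    ∑ q ∈ s, ‖(σ (c g q) : K →L[ℂ] K) (f (g⁻¹ • q))‖ ^ 2 ≤ (C * ‖f‖) ^ 2 := by
  classical
  calc ∑ q ∈ s, ‖(σ (c g q) : K →L[ℂ] K) (f (g⁻¹ • q))‖ ^ 2
      ≤ ∑ q ∈ s, C ^ 2 * ‖f (g⁻¹ • q)‖ ^ 2 := Finset.sum_le_sum fun q _ => by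
        rw [← mul_pow]
        exact pow_le_pow_left₀ (norm_nonneg _) (ContinuousLinearMap.le_of_opNorm_le _ (hC _) _) 2
    _ = C ^ 2 * ∑ q ∈ s.image (g⁻¹ • ·), ‖f q‖ ^ 2 := by
        rw [← Finset.mul_sum, Finset.sum_image fun _ _ _ _ h => MulAction.injective g⁻¹ h]
    _ ≤ (C * ‖f‖) ^ 2 := by
        rw [mul_pow]
        exact mul_le_mul_of_nonneg_left (lp_two_sum_le f _) (sq_nonneg C)

/-- The operator on `ℓ²` which permutes the coordinates by `g` and twists them by `σ (c g ·)`. -/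
noncomputable def cocycleOperator (σ : F →* (K →L[ℂ] K)ˣ) {C : ℝ} (hC0 : 0 ≤ C)
    (hC : ∀ x, ‖(σ x : K →L[ℂ] K)‖ ≤ C) (c : Γ → Q → F) (g : Γ) :
    lp (fun _ : Q => K) 2 →L[ℂ] lp (fun _ : Q => K) 2 :=
  LinearMap.mkContinuous
    { toFun := fun f => ⟨fun q => (σ (c g q) : K →L[ℂ] K) (f (g⁻¹ • q)),
        memlp_two_of_sum_le (sum_cocycle_le σ hC c g f)⟩
      map_add' := fun _ _ => lp.ext (funext fun q => map_add (σ (c g q) : K →L[ℂ] K) _ _)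
      map_smul' := fun a _ => lp.ext (funext fun q => map_smul (σ (c g q) : K →L[ℂ] K) a _) } C
    fun f => lp_two_norm_le (by positivity) (sum_cocycle_le σ hC c g f)

theorem cocycleOperator_apply (σ : F →* (K →L[ℂ] K)ˣ) {C : ℝ} (hC0 : 0 ≤ C)
    (hC : ∀ x, ‖(σ x : K →L[ℂ] K)‖ ≤ C) (c : Γ → Q → F) (g : Γ) (f : lp (fun _ : Q => K) 2)
    (q : Q) : cocycleOperator σ hC0 hC c g f q = (σ (c g q) : K →L[ℂ] K) (f (g⁻¹ • q)) := rfl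

theorem norm_cocycleOperator_le (σ : F →* (K →L[ℂ] K)ˣ) {C : ℝ} (hC0 : 0 ≤ C)
    (hC : ∀ x, ‖(σ x : K →L[ℂ] K)‖ ≤ C) (c : Γ → Q → F) (g : Γ) :
    ‖cocycleOperator σ hC0 hC c g‖ ≤ C :=
  ContinuousLinearMap.opNorm_le_bound _ hC0 fun f =>
    lp_two_norm_le (by positivity) (sum_cocycle_le σ hC c g f)

/-- The representation on `ℓ²` attached to a cocycle `c` for the action on the coordinates. -/
noncomputable def cocycleRep (σ : F →* (K →L[ℂ] K)ˣ) {C : ℝ} (hC0 : 0 ≤ C)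
    (hC : ∀ x, ‖(σ x : K →L[ℂ] K)‖ ≤ C) (c : Γ → Q → F) (h1 : ∀ q, c 1 q = 1)
    (hmul : ∀ g h q, c (g * h) q = c g q * c h (g⁻¹ • q)) :
    Γ →* (lp (fun _ : Q => K) 2 →L[ℂ] lp (fun _ : Q => K) 2)ˣ :=
  MonoidHom.toHomUnits
    { toFun := cocycleOperator σ hC0 hC c
      map_one' := by
        ext f q
        simp [cocycleOperator_apply, h1]
      map_mul' := fun g h => by
        ext f q
        simp [cocycleOperator_apply, hmul, mul_smul] }

theorem coe_cocycleRep (σ : F →* (K →L[ℂ] K)ˣ) {C : ℝ} (hC0 : 0 ≤ C)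
    (hC : ∀ x, ‖(σ x : K →L[ℂ] K)‖ ≤ C) (c : Γ → Q → F) (h1 : ∀ q, c 1 q = 1)
    (hmul : ∀ g h q, c (g * h) q = c g q * c h (g⁻¹ • q)) (g : Γ) :
    (cocycleRep σ hC0 hC c h1 hmul g : lp (fun _ : Q => K) 2 →L[ℂ] lp (fun _ : Q => K) 2) =
      cocycleOperator σ hC0 hC c g := rfl

theorem cocycleOperator_single [DecidableEq Q] (σ : F →* (K →L[ℂ] K)ˣ) {C : ℝ} (hC0 : 0 ≤ C)
    (hC : ∀ x, ‖(σ x : K →L[ℂ] K)‖ ≤ C) (c : Γ → Q → F) {g : Γ} {b : Q} (hb : g • b = b) (v : K) :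
    cocycleOperator σ hC0 hC c g (lp.single 2 b v) =
      lp.single 2 b ((σ (c g b) : K →L[ℂ] K) v) := by
  have hb' : g⁻¹ • b = b := inv_smul_eq_iff.2 hb.symm
  ext q
  rw [cocycleOperator_apply]
  by_cases hq : q = b
  · subst hq
    rw [hb', lp.single_apply_self, lp.single_apply_self]
  · rw [lp.single_apply_ne _ _ _ hq, lp.single_apply_ne, map_zero]
    rwa [Ne, inv_smul_eq_iff, hb]

end Cocycle

/-- A uniformly bounded representation of a subgroup is contained in the restriction of a uniformly
bounded representation of the group, the induced one. -/
theorem exists_inducedRep {F Γ K : Type*} [Group F] [Group Γ] [NormedAddCommGroup K]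
    [NormedSpace ℂ K] {j : F →* Γ} (hj : Function.Injective j) {σ : F →* (K →L[ℂ] K)ˣ}
    (hσ : IsUniformlyBounded σ) :
    ∃ π : Γ →* (lp (fun _ : Γ ⧸ j.range => K) 2 →L[ℂ] lp (fun _ : Γ ⧸ j.range => K) 2)ˣ,
      IsUniformlyBounded π ∧ ∀ q, (IsIsometrisableRep q π → IsIsometrisableRep q σ) := by
  classical
  obtain ⟨C, hC⟩ := hσ
  have hC0 : 0 ≤ C := (norm_nonneg _).trans (hC 1)
  -- The cocycle of the section `Quotient.out` of the coset space.
  have hcoc : ∀ (g : Γ) (q : Γ ⧸ j.range), ∃ x : F, j x = q.out⁻¹ * g * (g⁻¹ • q).out := by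
    intro g q
    have : q.out⁻¹ * (g * (g⁻¹ • q).out) ∈ j.range := by
      rw [← QuotientGroup.eq, QuotientGroup.out_eq']
      rw [← smul_eq_mul, ← MulAction.Quotient.smul_mk, QuotientGroup.out_eq', smul_inv_smul]
    obtain ⟨x, hx⟩ := this
    exact ⟨x, by rw [hx, mul_assoc]⟩
  choose c hc using hcoc
  have hc1 : ∀ q, c 1 q = 1 := fun q => hj (by simp [hc])
  have hcmul : ∀ g h q, c (g * h) q = c g q * c h (g⁻¹ • q) := fun g h q => hj (by
    rw [map_mul, hc, hc, hc, mul_inv_rev, mul_smul]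
    group)
  refine ⟨cocycleRep σ hC0 hC c hc1 hcmul, ⟨C, norm_cocycleOperator_le σ hC0 hC c⟩,
    fun q h => ?_⟩
  obtain ⟨b⟩ : Nonempty (Γ ⧸ j.range) := ⟨((1 : Γ) : Γ ⧸ j.range)⟩
  -- The chosen representative of `b` need not be `1`, so the copy of `σ` at `b` is found on a
  -- conjugate of the subgroup.
  have hfix : ∀ x, (b.out * j x * b.out⁻¹) • b = b := by
    intro x
    nth_rewrite 3 [← QuotientGroup.out_eq' b]
    rw [MulAction.Quotient.smul_mk, smul_eq_mul, inv_mul_cancel_right, eq_comm]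
    nth_rewrite 1 [← QuotientGroup.out_eq' b]
    rw [QuotientGroup.eq, inv_mul_cancel_left]
    exact ⟨x, rfl⟩
  have hcb : ∀ x, c (b.out * j x * b.out⁻¹) b = x := fun x => hj (by
    rw [hc, inv_smul_eq_iff.2 (hfix x).symm]
    group)
  refine h.of_intertwining (lpSingleIsometry b) (fun x => b.out * j x * b.out⁻¹) fun x v => ?_
  rw [coe_cocycleRep, lpSingleIsometry_apply, lpSingleIsometry_apply,
    cocycleOperator_single σ hC0 hC c (hfix x) v, hcb]

end Induction

/-! ### Free subgroups of infinite rank -/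

section FreeSubgroups

namespace FreeGroup

/-- The automorphisms of the free group on `ℤ` shifting the generators. -/
def shift : Multiplicative ℤ →* MulAut (FreeGroup ℤ) where
  toFun n := freeGroupCongr (Equiv.addRight n.toAdd)
  map_one' := by
    apply MulEquiv.toMonoidHom_injective
    ext i
    simp
  map_mul' m n := by
    apply MulEquiv.toMonoidHom_injective
    ext i
    simp [add_comm, add_left_comm]

theorem shift_apply_of (n : Multiplicative ℤ) (i : ℤ) : shift n (of i) = of (i + n.toAdd) := by
  simp [shift]

/-- The conjugates `a ^ k b a ^ (-k)` are free: sending `a` to the shift and `b` to the generator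
`of 0` in the semidirect product takes them to the generators `of k`. -/
theorem exists_injective_int_fin_two :
    ∃ ψ : FreeGroup ℤ →* FreeGroup (Fin 2), Function.Injective ψ := by
  let ψ : FreeGroup ℤ →* FreeGroup (Fin 2) := lift fun k => of 0 ^ k * of 1 * (of 0 ^ k)⁻¹
  let θ : FreeGroup (Fin 2) →* FreeGroup ℤ ⋊[shift] Multiplicative ℤ :=
    lift ![SemidirectProduct.inr (Multiplicative.ofAdd 1), SemidirectProduct.inl (of 0)]
  have h : θ.comp ψ = SemidirectProduct.inl := by
    ext1 k
    have : SemidirectProduct.inl (φ := shift) (of k) = SemidirectProduct.inl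
        (shift (Multiplicative.ofAdd (1 : ℤ) ^ k) (of 0)) := by
      rw [shift_apply_of]
      simp
    rw [this, SemidirectProduct.inl_aut]
    simp [ψ, θ]
  refine ⟨ψ, Function.Injective.of_comp (f := θ) ?_⟩
  rw [← MonoidHom.coe_comp, h]
  exact SemidirectProduct.inl_injective

theorem commute_of_subsingleton {ι : Type*} [Subsingleton ι] (x y : FreeGroup ι) :
    x * y = y * x := by
  have h1 : ∀ (i : ι) (x : FreeGroup ι), of i * x * (of i)⁻¹ = x := fun i x =>
    DFunLike.congr_fun (show (MulAut.conj (of i)).toMonoidHom = MonoidHom.id (FreeGroup ι) from by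
      ext k
      simp [Subsingleton.elim k i]) x
  have h2 : x * y * x⁻¹ = y :=
    DFunLike.congr_fun (show (MulAut.conj x).toMonoidHom = MonoidHom.id (FreeGroup ι) from by
      ext k
      have := h1 k x
      simp only [MulEquiv.toMonoidHom_eq_coe, MonoidHom.coe_coe, MulAut.conj_apply,
        MonoidHom.id_apply]
      rw [mul_inv_eq_iff_eq_mul] at this ⊢
      exact this.symm) y
  rwa [mul_inv_eq_iff_eq_mul] at h2

theorem exists_injective_of_nontrivial (ι : Type*) [Nontrivial ι] :
    ∃ ψ : FreeGroup ℤ →* FreeGroup ι, Function.Injective ψ := by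
  obtain ⟨i, k, hik⟩ := exists_pair_ne ι
  obtain ⟨ψ, hψ⟩ := exists_injective_int_fin_two
  have hf : Function.Injective ![i, k] := by
    intro a b
    fin_cases a <;> fin_cases b <;> simp [hik, hik.symm]
  exact ⟨(map ![i, k]).comp ψ, (map_injective hf).comp hψ⟩

end FreeGroup

theorem ContainsNonabelianFree.exists_injective {Γ : Type u} [Group Γ]
    (h : ContainsNonabelianFree Γ) : ∃ ψ : FreeGroup ℤ →* Γ, Function.Injective ψ := by
  obtain ⟨H, ⟨ι, ⟨B⟩⟩, a, ha, b, hb, hab⟩ := h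
  have : Nontrivial ι := by
    rw [← not_subsingleton_iff_nontrivial]
    intro hs
    have h1 : (⟨a, ha⟩ : H) * ⟨b, hb⟩ = ⟨b, hb⟩ * ⟨a, ha⟩ := by
      apply B.repr.injective
      rw [map_mul, map_mul, FreeGroup.commute_of_subsingleton]
    exact hab (congrArg Subtype.val h1)
  obtain ⟨ψ, hψ⟩ := FreeGroup.exists_injective_of_nontrivial ι
  exact ⟨H.subtype.comp (B.repr.symm.toMonoidHom.comp ψ),
    H.subtype_injective.comp (B.repr.symm.injective.comp hψ)⟩

end FreeSubgroups

/-! ### The main theorem -/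

theorem exists_hilbert_not_isIsometrisableRep {p : ℝ} (hp : 1 < p) {Γ : Type u} [Group Γ]
    {j : FreeGroup ℤ →* Γ} (hj : Function.Injective j) :
    ∃ (H : Type u) (_ : NormedAddCommGroup H) (_ : InnerProductSpace ℂ H) (_ : CompleteSpace H)
      (π : Γ →* (H →L[ℂ] H)ˣ), IsUniformlyBounded π ∧ ¬ IsIsometrisableRep p π := by
  obtain ⟨σ, hσ, hσp⟩ := exists_uniformlyBounded_not_isIsometrisableRep hp
  obtain ⟨π, hπ, hπσ⟩ := exists_inducedRep hj hσ
  exact ⟨_, inferInstance, inferInstance, inferInstance, π, hπ, fun h => hσp (hπσ p h)⟩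

theorem not_isPQIsometrisable {p q : ℝ} (hp : 0 < p) (hq : 1 < q) {Γ : Type u} [Group Γ]
    {j : FreeGroup ℤ →* Γ} (hj : Function.Injective j) : ¬ IsPQIsometrisable p q Γ := by
  obtain ⟨H, _, _, _, π, hπ, hπq⟩ := exists_hilbert_not_isIsometrisableRep hq hj
  exact fun h => hπq (h H (isPSpace_of_innerProductSpace hp H) π hπ)

theorem mainTheorem1 (p : ℝ) (hp : 1 < p) :
    (∀ r : ℕ, 2 ≤ r →
      ¬ IsPQIsometrisable 2 p (FreeGroup (Fin r)) ∧
      (∃ (H : Type) (_ : NormedAddCommGroup H) (_ : InnerProductSpace ℂ H) (_ : CompleteSpace H)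
        (π : FreeGroup (Fin r) →* (H →L[ℂ] H)ˣ),
        IsPSpace p H ∧ IsUniformlyBounded π ∧ ¬ IsIsometrisableRep p π) ∧
      ¬ IsPIsometrisable p (FreeGroup (Fin r))) ∧
    (∀ (Γ : Type u) [Group Γ], ContainsNonabelianFree Γ → ¬ IsPIsometrisable p Γ) := by
  have hp0 : 0 < p := zero_lt_one.trans hp
  refine ⟨fun r hr => ?_, fun Γ _ hΓ => ?_⟩
  · have : Nontrivial (Fin r) := Fin.nontrivial_iff_two_le.2 hr
    obtain ⟨j, hj⟩ := FreeGroup.exists_injective_of_nontrivial (Fin r)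
    refine ⟨not_isPQIsometrisable two_pos hp hj, ?_, not_isPQIsometrisable hp0 hp hj⟩
    obtain ⟨H, _, _, _, π, hπ, hπp⟩ := exists_hilbert_not_isIsometrisableRep hp hj
    exact ⟨H, inferInstance, inferInstance, inferInstance, π,
      isPSpace_of_innerProductSpace hp0 H, hπ, hπp⟩
  · obtain ⟨j, hj⟩ := hΓ.exists_injective
    exact not_isPQIsometrisable hp0 hp hj
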